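/- Consider a memory game with $2n$ cards bearing $n$ different labels, two cards for each label. The cards lie face down in a row, and their order is a permutation of the multiset $\{1,1,2,2,\dots,n,n\}$ chosen uniformly at random. At each move a player with perfect memory flips over two cards; if they match they are removed, otherwise they are turned face down again. She plays as follows. If before a move she knows the places of two matching cards that have not been removed, she flips and removes this pair. Otherwise she flips the leftmost card that has never been flipped; if its matching card has been flipped before, she flips that card again and removes the pair; if not, she flips the next card (from left to right) that has never been flipped. A move is called lucky if the two cards flipped in it are next to each other in the row, match, and neither of them was flipped before this move. Let $L_n$ be the number of lucky moves in the game. Then, as $n\to\infty$, $L_n$ converges in distribution to a Poisson random variable with parameter $\ln 2$: \[ L_n \xrightarrow{d} \mathrm{Pois}(\ln 2). \] -/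

import Mathlib

open MeasureTheory ProbabilityTheory Filter

/-- A deal of `n` pairs of cards in a row of `2n` positions: a labelling of the positions by
`n` labels that uses each label exactly twice, i.e. a permutation of `{1,1,2,2,…,n,n}`. -/
def Deal (n : ℕ) : Type :=
  {d : Fin (2 * n) → Fin n // ∀ i, (Finset.univ.filter fun j => d j = i).card = 2}

instance (n : ℕ) : Fintype (Deal n) :=
  inferInstanceAs (Fintype {d : Fin (2 * n) → Fin n //
    ∀ i, (Finset.univ.filter fun j => d j = i).card = 2})

instance (n : ℕ) : MeasurableSpace (Deal n) := ⊤

instance (n : ℕ) : Nonempty (Deal n) := by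
  refine ⟨⟨fun j => ⟨j.val / 2, by omega⟩, fun i => ?_⟩⟩
  have h : (Finset.univ.filter fun j : Fin (2 * n) => (⟨j.val / 2, by omega⟩ : Fin n) = i)
      = {⟨2 * i.val, by omega⟩, ⟨2 * i.val + 1, by omega⟩} := by
    ext j
    simp only [Finset.mem_filter, Finset.mem_univ, true_and, Finset.mem_insert,
      Finset.mem_singleton, Fin.ext_iff]
    omega
  rw [h, Finset.card_pair]
  simp [Fin.ext_iff]

/-- The moves of the player from the moment when the positions in `seen` have been flipped at
least once, those in the second list (from left to right) have never been flipped, and no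
unremoved matching pair is known. A move is the pair of positions flipped, in order.

She flips the first unflipped card `a`. If its mate `q` was seen, she flips `q` and removes the
pair. Otherwise she flips the next unflipped card `b`; if `b` does not match `a` but its mate `q`
was seen before, then her next move is to remove the pair `b`, `q`.

In a deal, a single unflipped card always has its mate in `seen`, so the value `[]` for a single
unflipped card without a seen mate is never used. -/
def play {n : ℕ} (d : Fin (2 * n) → Fin n) :
    List (Fin (2 * n)) → List (Fin (2 * n)) → List (Fin (2 * n) × Fin (2 * n))
  | _, [] => []
  | seen, [a] =>
    match seen.find? (fun q => d q = d a) with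
    | some q => [(a, q)]
    | none => []
  | seen, a :: b :: rest =>
    match seen.find? (fun q => d q = d a) with
    | some q => (a, q) :: play d (a :: seen) (b :: rest)
    | none =>
      if d a = d b then (a, b) :: play d (b :: a :: seen) rest
      else
        match seen.find? (fun q => d q = d b) with
        | some q => (a, b) :: (b, q) :: play d (b :: a :: seen) rest
        | none => (a, b) :: play d (b :: a :: seen) rest

/-- The sequence of moves of the whole game on the deal `d`. -/
def Deal.moves {n : ℕ} (d : Deal n) : List (Fin (2 * n) × Fin (2 * n)) :=
  play d.1 [] (List.finRange (2 * n))

/-- The `t`-th move of the game is lucky: its two cards are next to each other, they match, and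
neither of them was flipped in an earlier move. -/
def Deal.IsLucky {n : ℕ} (d : Deal n) (t : Fin d.moves.length) : Prop :=
  (d.moves.get t).1.val + 1 = (d.moves.get t).2.val ∧
  d.1 (d.moves.get t).1 = d.1 (d.moves.get t).2 ∧
  ∀ s < t, ∀ c ∈ [(d.moves.get s).1, (d.moves.get s).2],
    c ≠ (d.moves.get t).1 ∧ c ≠ (d.moves.get t).2

instance {n : ℕ} (d : Deal n) : DecidablePred d.IsLucky := fun t => by
  unfold Deal.IsLucky; infer_instance

/-- The number of lucky moves of the game on the deal `d`. -/
def Deal.luckyMoves {n : ℕ} (d : Deal n) : ℕ :=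
  (Finset.univ.filter fun t => d.IsLucky t).card

/-- The uniform distribution on the deals of `n` pairs. -/
noncomputable def uniformDeal (n : ℕ) : Measure (Deal n) :=
  (PMF.uniformOfFintype (Deal n)).toMeasure

instance (n : ℕ) : IsProbabilityMeasure (uniformDeal n) :=
  inferInstanceAs (IsProbabilityMeasure (PMF.uniformOfFintype (Deal n)).toMeasure)

/-! Only the word of labels matters. The unflipped cards always form a final segment of the row, so
the first two of them are adjacent, and a move is lucky exactly when they match. If `k` labels are
unseen and `u` labels have one card flipped and one not, the remaining `m = 2k + u` cards are in
uniformly random order, so the generating function of the lucky moves still to come depends only on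
`(k, u)`. Conditioning on the next card, and on the one after it if the label is new, gives the
recursion of `luckyPGF`; `sum_luckyWord` proves this by counting words.

Put `y = 2k / m`. A step is lucky with probability `q = 2k / (m (m - 1))`, and its mean change of
`y` is `-q (1 + y)` up to lower order. Hence the generating function should be close to a solution
of `(1 + y) φ' = (z - 1) φ` with `φ 0 = 1`, that is `φ y = (1 + y) ^ (z - 1)`. As `y` falls from 1
to 0 the accumulated rate of luck is `∫ dy / (1 + y) = ln 2`, and `φ 1` is the Poisson generating
function.

To make this rigorous, `exists_limitPGF_consistency` bounds the local error of `φ` in the recursion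
by a multiple of `k / (m² (m - 1))`. `errorBound_supersolution` supplies a function that absorbs
such errors, and `exists_luckyPGF_error` compares by induction. At `(n, 0)` the bound is `O(log n /
n)`. With `z = exp (i t)` this is convergence of characteristic functions, and Lévy's continuity
theorem concludes. -/

/-! ### From the game to words of labels -/

/-- The number of lucky moves in a list of moves, when the positions in `P` have been flipped
before. -/
def luckyFrom {n : ℕ} (d : Fin (2 * n) → Fin n) :
    List (Fin (2 * n)) → List (Fin (2 * n) × Fin (2 * n)) → ℕ
  | _, [] => 0
  | P, m :: ms =>
    (if m.1.val + 1 = m.2.val ∧ d m.1 = d m.2 ∧ m.1 ∉ P ∧ m.2 ∉ P then 1 else 0) +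
      luckyFrom d (m.1 :: m.2 :: P) ms

/-- The number of lucky moves as a function of the word of labels of the unflipped cards, when
the labels in `T` have been seen. -/
def luckyWord {α : Type*} [DecidableEq α] : Finset α → List α → ℕ
  | _, [] => 0
  | _, [_] => 0
  | T, a :: b :: r =>
    if a ∈ T then luckyWord T (b :: r)
    else (if a = b then 1 else 0) + luckyWord (insert b (insert a T)) r

/-- Allowing an arbitrary list `P` of earlier flips makes the count inductive: peeling off the first
move transfers its two cards to `P`. -/
lemma card_lucky_eq_luckyFrom {n : ℕ} (d : Fin (2 * n) → Fin n)
    (l : List (Fin (2 * n) × Fin (2 * n))) (P : List (Fin (2 * n))) :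
    (Finset.univ.filter fun t : Fin l.length => (l.get t).1.val + 1 = (l.get t).2.val ∧
      d (l.get t).1 = d (l.get t).2 ∧ ((l.get t).1 ∉ P ∧ (l.get t).2 ∉ P) ∧
      ∀ s < t, ∀ c ∈ [(l.get s).1, (l.get s).2], c ≠ (l.get t).1 ∧ c ≠ (l.get t).2).card
      = luckyFrom d P l := by
  induction l generalizing P with
  | nil => simp [luckyFrom]
  | cons m ms ih =>
    rw [luckyFrom, ← ih (m.1 :: m.2 :: P)]
    simp only [List.length_cons]
    rw [Fin.card_filter_univ_succ]
    have hrest : (Finset.univ.filter fun t : Fin ms.length =>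
        ((m :: ms).get t.succ).1.val + 1 = ((m :: ms).get t.succ).2.val ∧
        d ((m :: ms).get t.succ).1 = d ((m :: ms).get t.succ).2 ∧
        (((m :: ms).get t.succ).1 ∉ P ∧ ((m :: ms).get t.succ).2 ∉ P) ∧
        ∀ s < t.succ, ∀ c ∈ [((m :: ms).get s).1, ((m :: ms).get s).2],
          c ≠ ((m :: ms).get t.succ).1 ∧ c ≠ ((m :: ms).get t.succ).2) =
        (Finset.univ.filter fun t : Fin ms.length => (ms.get t).1.val + 1 = (ms.get t).2.val ∧
          d (ms.get t).1 = d (ms.get t).2 ∧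
          ((ms.get t).1 ∉ m.1 :: m.2 :: P ∧ (ms.get t).2 ∉ m.1 :: m.2 :: P) ∧
          ∀ s < t, ∀ c ∈ [(ms.get s).1, (ms.get s).2],
            c ≠ (ms.get t).1 ∧ c ≠ (ms.get t).2) := by
      ext t
      simp only [Finset.mem_filter, Finset.mem_univ, true_and, Fin.forall_fin_succ,
        Fin.succ_lt_succ_iff, Fin.succ_pos, true_implies]
      simp only [List.get_eq_getElem, Fin.val_succ, List.getElem_cons_succ, Fin.val_zero,
        List.getElem_cons_zero, List.mem_cons, List.not_mem_nil, or_false, forall_eq_or_imp,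
        forall_eq, not_or]
      refine and_congr_right fun _ => and_congr_right fun _ => ?_
      rw [← and_assoc]
      refine and_congr_left fun _ => ?_
      simp only [ne_comm, ne_eq]
      tauto
    have hzero : (((m :: ms).get (0 : Fin (ms.length + 1))).1.val + 1 =
        ((m :: ms).get (0 : Fin (ms.length + 1))).2.val ∧
        d ((m :: ms).get (0 : Fin (ms.length + 1))).1 =
          d ((m :: ms).get (0 : Fin (ms.length + 1))).2 ∧
        (((m :: ms).get (0 : Fin (ms.length + 1))).1 ∉ P ∧
          ((m :: ms).get (0 : Fin (ms.length + 1))).2 ∉ P) ∧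
        ∀ s < (0 : Fin (ms.length + 1)), ∀ c ∈ [((m :: ms).get s).1, ((m :: ms).get s).2],
          c ≠ ((m :: ms).get (0 : Fin (ms.length + 1))).1 ∧
          c ≠ ((m :: ms).get (0 : Fin (ms.length + 1))).2) ↔
        (m.1.val + 1 = m.2.val ∧ d m.1 = d m.2 ∧ m.1 ∉ P ∧ m.2 ∉ P) := by
      simp
    simp only [hrest, hzero]
    split_ifs <;> omega

lemma luckyMoves_eq_luckyFrom {n : ℕ} (d : Deal n) :
    d.luckyMoves = luckyFrom d.1 [] d.moves := by
  rw [← card_lucky_eq_luckyFrom]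
  unfold Deal.luckyMoves Deal.IsLucky
  simp

lemma find?_eq_none_iff_label {n : ℕ} (d : Fin (2 * n) → Fin n) (seen : List (Fin (2 * n)))
    (T : Finset (Fin n)) (hT : ∀ l, l ∈ T ↔ ∃ q ∈ seen, d q = l) (a : Fin (2 * n)) :
    seen.find? (fun q => d q = d a) = none ↔ d a ∉ T := by
  rw [hT]; simp

/-- From a state in which the seen positions are disjoint from the consecutive unflipped ones,
the number of lucky moves depends only on the labels. -/
lemma luckyFrom_play {n : ℕ} (d : Fin (2 * n) → Fin n) (seen rest : List (Fin (2 * n)))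
    (P : List (Fin (2 * n))) (T : Finset (Fin n)) (hP : ∀ x, x ∈ P ↔ x ∈ seen)
    (hT : ∀ l, l ∈ T ↔ ∃ q ∈ seen, d q = l)
    (hc : rest.IsChain fun a b => a.val + 1 = b.val) (hn : rest.Nodup)
    (hd : ∀ x ∈ rest, x ∉ seen) :
    luckyFrom d P (play d seen rest) = luckyWord T (rest.map d) := by
  induction hlen : rest.length using Nat.strong_induction_on generalizing seen rest P T with
  | _ N ih =>
  match rest, hlen with
  | [], _ => simp [play, luckyFrom, luckyWord]
  | [a], _ =>
    rw [play]
    cases hf : seen.find? (fun q => d q = d a) with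
    | none => simp [luckyFrom, luckyWord]
    | some q =>
      have hq : q ∈ P := (hP q).2 (List.mem_of_find?_eq_some hf)
      simp [luckyFrom, luckyWord, hq]
  | a :: b :: r, hlen =>
    -- The adjacency clause in the definition of luck is automatic for a move on two fresh cards.
    have hab : a.val + 1 = b.val := (List.isChain_cons_cons.1 hc).1
    have hcb : (b :: r).IsChain fun a b => a.val + 1 = b.val := (List.isChain_cons_cons.1 hc).2
    have hcr : r.IsChain fun a b => a.val + 1 = b.val := hcb.tail
    have hnb : (b :: r).Nodup := (List.nodup_cons.1 hn).2
    have hanb : a ∉ b :: r := (List.nodup_cons.1 hn).1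
    have hnr : r.Nodup := (List.nodup_cons.1 hnb).2
    have hbr : b ∉ r := (List.nodup_cons.1 hnb).1
    have har : a ∉ r := fun h => hanb (List.mem_cons_of_mem _ h)
    have haP : a ∉ P := fun h => hd a (by simp) ((hP a).1 h)
    have hbP : b ∉ P := fun h => hd b (by simp) ((hP b).1 h)
    have hlr : r.length < N := by simp at hlen; omega
    have hlb : (b :: r).length < N := by simp at hlen ⊢; omega
    have hT' : ∀ l, l ∈ insert (d b) (insert (d a) T) ↔ ∃ q ∈ b :: a :: seen, d q = l := by
      intro l
      simp [hT, eq_comm]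
    have hdr : ∀ x ∈ r, x ∉ b :: a :: seen := by
      intro x hx
      simp only [List.mem_cons, not_or]
      exact ⟨fun h => hbr (h ▸ hx), fun h => har (h ▸ hx), hd x (by simp [hx])⟩
    rw [play]
    cases hf : seen.find? (fun q => d q = d a) with
    | some q =>
      have hqs : q ∈ seen := List.mem_of_find?_eq_some hf
      have hq : q ∈ P := (hP q).2 hqs
      have hqa : d q = d a := by simpa using List.find?_some hf
      have haT : d a ∈ T := (hT _).2 ⟨q, hqs, hqa⟩
      simp only [luckyFrom, hq, not_true_eq_false, and_false, if_false, zero_add, List.map_cons,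
        luckyWord, haT, if_true]
      refine ih _ hlb (a :: seen) (b :: r) _ T ?_ ?_ hcb hnb ?_ rfl
      · intro x
        simp only [List.mem_cons, hP]
        constructor
        · rintro (h | h | h) <;> simp_all
        · tauto
      · intro l
        rw [hT]
        constructor
        · rintro ⟨p, hp, rfl⟩; exact ⟨p, by simp [hp], rfl⟩
        · rintro ⟨p, hp, rfl⟩
          rcases List.mem_cons.1 hp with rfl | hp
          · exact ⟨q, hqs, hqa⟩
          · exact ⟨p, hp, rfl⟩
      · intro x hx
        simp only [List.mem_cons, not_or]
        exact ⟨fun h => hanb (h ▸ hx), hd x (List.mem_cons_of_mem _ hx)⟩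
    | none =>
      have haT : d a ∉ T := (find?_eq_none_iff_label d seen T hT a).1 hf
      simp only [List.map_cons, luckyWord, haT, if_false]
      by_cases hdab : d a = d b
      · simp only [hdab, if_true, luckyFrom, hab, haP, hbP, not_false_eq_true, and_self]
        congr 1
        rw [← hdab]
        refine ih _ hlr (b :: a :: seen) r _ _ ?_ (by rw [← hdab] at hT'; exact hT') hcr hnr hdr rfl
        intro x
        simp only [List.mem_cons, hP]
        tauto
      · simp only [hdab, if_false]
        cases hg : seen.find? (fun q => d q = d b) with
        | some q =>
          have hqs : q ∈ seen := List.mem_of_find?_eq_some hg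
          -- The extra move `(b, q)` that collects a known pair is not lucky, since `b` was flipped
          -- in the move just before it.
          simp only [luckyFrom, hdab, false_and, and_false, if_false, zero_add, List.mem_cons,
            true_or, or_true, not_true_eq_false]
          refine ih _ hlr (b :: a :: seen) r _ _ ?_ hT' hcr hnr hdr rfl
          intro x
          simp only [List.mem_cons, hP]
          constructor
          · rintro (h | h | h | h | h) <;> simp_all
          · tauto
        | none =>
          simp only [luckyFrom, hdab, false_and, and_false, if_false, zero_add]
          refine ih _ hlr (b :: a :: seen) r _ _ ?_ hT' hcr hnr hdr rfl
          intro x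
          simp only [List.mem_cons, hP]
          tauto

lemma isChain_finRange (m : ℕ) :
    (List.finRange m).IsChain fun a b => a.val + 1 = b.val := by
  rw [List.isChain_iff_getElem]
  intro i hi
  simp

lemma luckyMoves_eq_luckyWord {n : ℕ} (d : Deal n) :
    d.luckyMoves = luckyWord ∅ (List.ofFn d.1) := by
  rw [luckyMoves_eq_luckyFrom, Deal.moves, List.ofFn_eq_map]
  exact luckyFrom_play d.1 [] _ [] ∅ (by simp) (by simp) (isChain_finRange _)
    (List.nodup_finRange _) (by simp)

/-! ### The recursion for the generating function -/

/-- The generating function of the number of lucky moves from a state with `k` labels never seen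
and `u` labels seen once, evaluated at `z`. -/
noncomputable def luckyPGF (z : ℂ) : ℕ → ℕ → ℂ
  | 0, _ => 1
  | k + 1, u =>
    (match u with
      | 0 => 0
      | v + 1 => ((v + 1 : ℕ) : ℂ) / (2 * (k + 1) + (v + 1 : ℕ)) * luckyPGF z (k + 1) v) +
    2 * (k + 1) / ((2 * (k + 1) + u) * (2 * k + 1 + u)) *
      ((z + u) * luckyPGF z k u + 2 * k * luckyPGF z (k - 1) (u + 2))
termination_by k u => (k, u)

lemma luckyPGF_zero (z : ℂ) (u : ℕ) : luckyPGF z 0 u = 1 := by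
  rw [luckyPGF]

/-- The truncated `u - 1` and `k - 1` are harmless: their terms carry the factors `u` and `2 * k`.
-/
lemma luckyPGF_succ (z : ℂ) (k u : ℕ) :
    luckyPGF z (k + 1) u = u / (2 * (k + 1) + u) * luckyPGF z (k + 1) (u - 1) +
    2 * (k + 1) / ((2 * (k + 1) + u) * (2 * k + 1 + u)) *
      ((z + u) * luckyPGF z k u + 2 * k * luckyPGF z (k - 1) (u + 2)) := by
  rw [luckyPGF.eq_def]
  cases u <;> simp

/-! ### The limiting function and its Taylor estimates -/

/-- A second-order Taylor bound on an interval. -/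
lemma exists_taylor_bound {f f' f'' : ℝ → ℂ} {a b : ℝ}
    (hf : ∀ x ∈ Set.Icc a b, HasDerivAt f (f' x) x)
    (hf' : ∀ x ∈ Set.Icc a b, HasDerivAt f' (f'' x) x)
    (hc : ContinuousOn f'' (Set.Icc a b)) :
    ∃ B : ℝ, 0 ≤ B ∧ (∀ x ∈ Set.Icc a b, ‖f x‖ ≤ B) ∧
      (∀ x ∈ Set.Icc a b, ∀ y ∈ Set.Icc a b, ‖f y - f x‖ ≤ B * |y - x|) ∧
      ∀ x ∈ Set.Icc a b, ∀ y ∈ Set.Icc a b, ‖f y - f x - (y - x) * f' x‖ ≤ B * (y - x) ^ 2 := by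
  obtain ⟨B₀, h₀⟩ := isCompact_Icc.exists_bound_of_continuousOn
    (fun x hx => (hf x hx).continuousAt.continuousWithinAt : ContinuousOn f (Set.Icc a b))
  obtain ⟨B₁, h₁⟩ := isCompact_Icc.exists_bound_of_continuousOn
    (fun x hx => (hf' x hx).continuousAt.continuousWithinAt : ContinuousOn f' (Set.Icc a b))
  obtain ⟨B₂, h₂⟩ := isCompact_Icc.exists_bound_of_continuousOn hc
  obtain ⟨B, hB0, hB1, hB2, hB⟩ : ∃ B, B₀ ≤ B ∧ B₁ ≤ B ∧ B₂ ≤ B ∧ 0 ≤ B :=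
    ⟨max (max B₀ B₁) (max B₂ 0), by simp, by simp, by simp, by simp⟩
  refine ⟨B, hB, fun x hx => (h₀ x hx).trans hB0, fun x hx y hy => ?_, fun x hx y hy => ?_⟩
  · exact (convex_Icc a b).norm_image_sub_le_of_norm_hasDerivWithin_le
      (fun t ht => (hf t ht).hasDerivWithinAt) (fun t ht => (h₁ t ht).trans hB1) hx hy
  · have hsub : Set.uIcc x y ⊆ Set.Icc a b := Set.uIcc_subset_Icc hx hy
    have hlip : ∀ t ∈ Set.uIcc x y, ‖f' t - f' x‖ ≤ B * |y - x| := by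
      intro t ht
      refine ((convex_Icc a b).norm_image_sub_le_of_norm_hasDerivWithin_le
        (fun t ht => (hf' t ht).hasDerivWithinAt) (fun t ht => (h₂ t ht).trans hB2) hx
        (hsub ht)).trans ?_
      rw [Real.norm_eq_abs]
      gcongr ?_ * ?_
      exact Set.abs_sub_left_of_mem_uIcc ht
    have hd : ∀ t ∈ Set.uIcc x y,
        HasDerivWithinAt (fun t : ℝ => f t - (t : ℂ) * f' x) (f' t - f' x) (Set.uIcc x y) t := by
      intro t ht
      have h := (hf t (hsub ht)).sub ((Complex.ofRealCLM.hasDerivAt (x := t)).mul_const (f' x))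
      exact (h.congr_deriv (by simp)).hasDerivWithinAt
    have := (convex_uIcc x y).norm_image_sub_le_of_norm_hasDerivWithin_le hd hlip
      Set.left_mem_uIcc Set.right_mem_uIcc
    calc _ = ‖f y - (y : ℂ) * f' x - (f x - (x : ℂ) * f' x)‖ := by congr 1; ring
      _ ≤ B * |y - x| * ‖y - x‖ := this
      _ = _ := by rw [Real.norm_eq_abs, mul_assoc, abs_mul_abs_self]; ring

/-- The limiting generating function from a state in which a fraction `y` of the unflipped cards
have a label never seen. -/
noncomputable def limitPGF (z : ℂ) (y : ℝ) : ℂ := Complex.exp ((z - 1) * Real.log (1 + y))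

lemma hasDerivAt_limitPGF (z : ℂ) {y : ℝ} (hy : 0 ≤ y) :
    HasDerivAt (limitPGF z) ((z - 1) / (1 + y) * limitPGF z y) y := by
  have h1 : HasDerivAt (fun y : ℝ => Real.log (1 + y)) (1 / (1 + y)) y :=
    ((hasDerivAt_id y).const_add 1).log (by simp; positivity)
  have := ((h1.ofReal_comp).const_mul (z - 1)).cexp
  refine this.congr_deriv ?_
  rw [limitPGF]
  push_cast
  ring

lemma exists_limitPGF_taylor_bound (z : ℂ) :
    ∃ B : ℝ, 0 ≤ B ∧ (∀ x ∈ Set.Icc (0 : ℝ) 1, ‖limitPGF z x‖ ≤ B) ∧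
      (∀ x ∈ Set.Icc (0 : ℝ) 1, ∀ y ∈ Set.Icc (0 : ℝ) 1,
        ‖limitPGF z y - limitPGF z x‖ ≤ B * |y - x|) ∧
      ∀ x ∈ Set.Icc (0 : ℝ) 1, ∀ y ∈ Set.Icc (0 : ℝ) 1,
        ‖limitPGF z y - limitPGF z x - (y - x) * ((z - 1) / (1 + x) * limitPGF z x)‖ ≤
          B * (y - x) ^ 2 := by
  have hne : ∀ x ∈ Set.Icc (0 : ℝ) 1, (1 + x : ℂ) ≠ 0 := by
    intro x hx
    have : (1 + x : ℝ) ≠ 0 := by linarith [hx.1]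
    exact_mod_cast this
  have hinv : ∀ x ∈ Set.Icc (0 : ℝ) 1, HasDerivAt (fun x : ℝ => (z - 1) / (1 + x : ℂ))
      (-((z - 1) / (1 + x) ^ 2)) x := by
    intro x hx
    have h := (((Complex.ofRealCLM.hasDerivAt (x := x)).const_add 1).inv
      (hne x hx)).const_mul (z - 1)
    exact h.congr_deriv (by simp [div_eq_mul_inv])
  refine exists_taylor_bound (fun x hx => hasDerivAt_limitPGF z hx.1)
    (fun x hx => (hinv x hx).mul (hasDerivAt_limitPGF z hx.1)) ?_
  have hl : ContinuousOn (limitPGF z) (Set.Icc 0 1) :=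
    fun x hx => (hasDerivAt_limitPGF z hx.1).continuousAt.continuousWithinAt
  have hden : ContinuousOn (fun x : ℝ => (1 + x : ℂ)) (Set.Icc 0 1) := by fun_prop
  have hq : ContinuousOn (fun x : ℝ => (z - 1) / (1 + x : ℂ)) (Set.Icc 0 1) :=
    continuousOn_const.div hden hne
  exact (((continuousOn_const.div (hden.pow 2) fun x hx => pow_ne_zero 2 (hne x hx)).neg).mul
    hl).add (hq.mul (hq.mul hl))

/-! ### The function that absorbs the local errors -/

/-- The function that dominates the error of the limiting generating function. -/
noncomputable def errorBound (k u : ℕ) : ℝ :=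
  k / ((2 * k + u) * (2 * k + u - 1)) * (harmonic (2 * k + u) : ℝ)

lemma errorBound_nonneg (k u : ℕ) : 0 ≤ errorBound k u := by
  unfold errorBound
  rcases Nat.eq_zero_or_pos k with rfl | hk
  · simp
  · have h1 : (1 : ℝ) ≤ k := by exact_mod_cast hk
    have hu : (0 : ℝ) ≤ u := u.cast_nonneg
    have hh : (0 : ℝ) ≤ (harmonic (2 * k + u) : ℝ) := by
      exact_mod_cast (harmonic_pos (by omega : 2 * k + u ≠ 0)).le
    have : (0 : ℝ) ≤ 2 * k + u - 1 := by linarith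
    positivity

lemma harmonic_cast_mono {a b : ℕ} (h : a ≤ b) : (harmonic a : ℝ) ≤ harmonic b := by
  have : Monotone harmonic := monotone_nat_of_le_succ fun n => by
    rw [harmonic_succ]
    have : (0 : ℚ) ≤ (↑(n + 1))⁻¹ := by positivity
    linarith
  exact_mod_cast this h

/-- With `m` cards left, `2k / (m (m - 1))` is the chance that the last two cards of the row match,
so for `m > 2` it is a martingale and `k / (m (m - 1))` solves the homogeneous recursion at `z = 1`.
Multiplying by the harmonic number of `m` gains `1 / m` at each state, which pays exactly for the
source term. -/
lemma errorBound_supersolution (k u : ℕ) :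
    (u : ℝ) / (2 * (k + 1) + u) * errorBound (k + 1) (u - 1) +
    2 * (k + 1) / ((2 * (k + 1) + u) * (2 * k + 1 + u)) *
      ((1 + u) * errorBound k u + 2 * k * errorBound (k - 1) (u + 2)) +
    (k + 1) / ((2 * (k + 1) + u) ^ 2 * (2 * k + 1 + u)) ≤ errorBound (k + 1) u := by
  set H : ℝ := (harmonic (2 * k + 1 + u) : ℝ) with hH
  have hk : (0 : ℝ) ≤ k := k.cast_nonneg
  have hu : (0 : ℝ) ≤ u := u.cast_nonneg
  have hH0 : 0 ≤ H := by
    rw [hH]; exact_mod_cast (harmonic_pos (by omega : 2 * k + 1 + u ≠ 0)).le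
  -- Splitting off the last term of the harmonic number produces the source term. All successor
  -- states have at most `2k + 1 + u` cards, so their harmonic numbers are at most `H`.
  have e0 : errorBound (k + 1) u = (k + 1) / ((2 * (k + 1) + u) * (2 * k + 1 + u)) * H +
      (k + 1) / ((2 * (k + 1) + u) ^ 2 * (2 * k + 1 + u)) := by
    unfold errorBound
    rw [show 2 * (k + 1) + u = (2 * k + 1 + u) + 1 by ring, harmonic_succ]
    push_cast
    rw [← hH, show (2 * ((k : ℝ) + 1) + u - 1) = 2 * k + 1 + u by ring,
      show ((2 : ℝ) * k + 1 + u + 1) = 2 * (k + 1) + u by ring]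
    have h2 : (2 * ((k : ℝ) + 1) + u) ≠ 0 := by positivity
    have h3 : (2 * (k : ℝ) + 1 + u) ≠ 0 := by positivity
    field_simp
  rw [e0]
  gcongr ?_ + _
  -- With only two cards left the martingale identity would divide by zero; there every error term
  -- of the successors vanishes.
  rcases Nat.eq_zero_or_pos (2 * k + u) with hz | hz
  · obtain rfl : k = 0 := by omega
    obtain rfl : u = 0 := by omega
    simp [errorBound]
    linarith
  have hm : (0 : ℝ) < 2 * k + u := by exact_mod_cast hz
  have e1 : (u : ℝ) * errorBound (k + 1) (u - 1) ≤
      u * ((k + 1) / ((2 * k + 1 + u) * (2 * k + u)) * H) := by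
    rcases Nat.eq_zero_or_pos u with rfl | hu1
    · simp
    · apply mul_le_mul_of_nonneg_left _ hu
      unfold errorBound
      rw [show 2 * (k + 1) + (u - 1) = 2 * k + 1 + u by omega, Nat.cast_sub hu1]
      push_cast
      rw [← hH]
      apply le_of_eq
      congr 3 <;> ring
  have e2 : ∀ j v : ℕ, 2 * j + v ≤ 2 * k + u → errorBound j v ≤
      j / ((2 * j + v) * (2 * j + v - 1)) * H := by
    intro j v hv
    unfold errorBound
    rcases Nat.eq_zero_or_pos j with rfl | hj
    · simp
    · have h1 : (1 : ℝ) ≤ j := by exact_mod_cast hj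
      have hv : (0 : ℝ) ≤ v := v.cast_nonneg
      have : (0 : ℝ) ≤ 2 * j + v - 1 := by linarith
      gcongr
      exact harmonic_cast_mono (by omega)
  have e3 : (1 + u) * errorBound k u + 2 * k * errorBound (k - 1) (u + 2) ≤
      k / (2 * k + u) * H := by
    rcases Nat.eq_zero_or_pos k with rfl | hk1
    · simp [errorBound]
    · have h1 : (1 : ℝ) ≤ k := by exact_mod_cast hk1
      have a1 := e2 k u le_rfl
      have a2 := e2 (k - 1) (u + 2) (by omega)
      rw [Nat.cast_sub hk1] at a2
      push_cast at a2
      rw [show (2 * ((k : ℝ) - 1) + (u + 2)) = 2 * k + u by ring] at a2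
      have hm1 : (0 : ℝ) < 2 * k + u - 1 := by linarith
      calc _ ≤ (1 + u) * (k / ((2 * k + u) * (2 * k + u - 1)) * H) +
            2 * k * ((k - 1) / ((2 * k + u) * (2 * k + u - 1)) * H) := by gcongr
        _ = _ := by
          obtain ⟨w, hw⟩ : ∃ w : ℝ, w = 2 * k + u - 1 := ⟨_, rfl⟩
          rw [← hw] at hm1 ⊢
          rw [show (u : ℝ) = w + 1 - 2 * k by linarith]
          have hw2 : (2 * k + (w + 1 - 2 * k) : ℝ) ≠ 0 := by linarith
          field_simp
          ring
  calc _ = 1 / (2 * (k + 1) + u) * (u * errorBound (k + 1) (u - 1)) +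
        2 * (k + 1) / ((2 * (k + 1) + u) * (2 * k + 1 + u)) *
        ((1 + u) * errorBound k u + 2 * k * errorBound (k - 1) (u + 2)) := by ring
    _ ≤ 1 / (2 * (k + 1) + u) * (u * ((k + 1) / ((2 * k + 1 + u) * (2 * k + u)) * H)) +
        2 * (k + 1) / ((2 * (k + 1) + u) * (2 * k + 1 + u)) * (k / (2 * k + u) * H) := by
      gcongr
    _ = _ := by
      field_simp
      ring

/-! ### Comparison of the generating function with its limit -/

/-- Expand `φ₁`, `φ₂`, `φ₃`, the values at the three successor states, to first order at `y`. The
zeroth order cancels because the weights sum to one, the first order because of the differential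
equation `hcz`; what is left is quadratic in the displacements or has an extra factor `1 / m`. The
hypotheses `d₁` and `d₃` keep the factors `u` and `2 * k` because truncated subtraction spoils `y₁`
at `u = 0` and `y₃` at `k = 0`. -/
lemma norm_recursion_error_le {k u m y y₁ y₂ y₃ B : ℝ} {z c φ φ₁ φ₂ φ₃ : ℂ}
    (hm : m = 2 * (k + 1) + u) (hk : 0 ≤ k) (hu : 0 ≤ u) (hm3 : 3 ≤ m) (hB : 0 ≤ B)
    (hy : y = 2 * (k + 1) / m)
    (d₁ : u * (y₁ - y) = u * (2 * (k + 1) / (m * (m - 1))))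
    (d₂ : y₂ - y = -(2 * u) / (m * (m - 2)))
    (d₃ : 2 * k * (y₃ - y) = 2 * k * (-(2 * m + 2 * u) / (m * (m - 2))))
    (hcz : (z - 1) * φ = (1 + y) * c) (hcn : ‖c‖ ≤ ‖z - 1‖ * B)
    (t₁ : ‖φ₁ - φ - (y₁ - y) * c‖ ≤ B * (y₁ - y) ^ 2)
    (t₂ : ‖φ₂ - φ - (y₂ - y) * c‖ ≤ B * (y₂ - y) ^ 2)
    (t₃ : ‖φ₃ - φ - (y₃ - y) * c‖ ≤ B * (y₃ - y) ^ 2)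
    (l₂ : ‖φ₂ - φ‖ ≤ B * |y₂ - y|) :
    ‖(u : ℂ) / m * φ₁ + (2 * (k + 1) / (m * (m - 1)) : ℝ) * ((z + u) * φ₂ + 2 * k * φ₃) - φ‖ ≤
      (298 * B + 8 * ‖z - 1‖ * B) * ((k + 1) / (m ^ 2 * (m - 1))) := by
  have hm1 : (0 : ℝ) < m - 1 := by linarith
  have hm2 : (0 : ℝ) < m - 2 := by linarith
  have hm0 : (0 : ℝ) < m := by linarith
  have hum : m * u ≤ m * (m - 2) := mul_le_mul_of_nonneg_left (by linarith) hm0.le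
  have hum' : m * (2 * m + 2 * u) ≤ m * (12 * (m - 2)) :=
    mul_le_mul_of_nonneg_left (by linarith) hm0.le
  obtain ⟨q, hq⟩ : ∃ q : ℝ, q = 2 * (k + 1) / (m * (m - 1)) := ⟨_, rfl⟩
  have hq0 : 0 ≤ q := by rw [hq]; positivity
  -- `D` is the part of the mean displacement that `-q (1 + y)` misses; it equals `-q (y₂ - y)`, so
  -- it is smaller than `q` by a factor of order `1 / m`.
  obtain ⟨D, hD⟩ : ∃ D : ℝ, D = q * (2 * u / (m * (m - 2))) := ⟨_, rfl⟩
  have hP : u / m + q * (1 + u) + 2 * k * q = 1 := by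
    rw [hq, show u = m - 2 * (k + 1) by linarith]
    field_simp
    ring
  have hdrift : u / m * (y₁ - y) + q * ((1 + u) * (y₂ - y) + 2 * k * (y₃ - y)) +
      q * (1 + y) = D := by
    rw [d₃, d₂, show u / m * (y₁ - y) = u * (y₁ - y) / m by ring, d₁, hD, hy]
    rw [hq, show u = m - 2 * (k + 1) by linarith]
    field_simp
    ring
  obtain ⟨τ, hτ⟩ : ∃ τ : ℝ, τ = (k + 1) / (m ^ 2 * (m - 1)) := ⟨_, rfl⟩
  have hτ0 : 0 ≤ τ := by rw [hτ]; positivity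
  -- `τ` is the unit of local error. Weights up to `m` times squared displacements of order `1 /
  -- m²`, multiplied by `q`, are therefore of order `τ`.
  have hqτ : q = 2 * m * τ := by rw [hq, hτ]; field_simp
  have habs₂ : |y₂ - y| ≤ 2 / m := by
    rw [d₂, abs_div, abs_neg, abs_of_nonneg (by positivity : (0 : ℝ) ≤ 2 * u),
      abs_of_pos (by positivity), div_le_div_iff₀ (by positivity) hm0]
    linarith
  have s₁ : u / m * (y₁ - y) ^ 2 ≤ 2 * τ := by
    have e : u * (y₁ - y) ^ 2 = u * (2 * (k + 1) / (m * (m - 1))) ^ 2 := by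
      rcases eq_or_ne u 0 with h | h
      · simp [h]
      · rw [mul_left_cancel₀ h d₁]
    have e' : u / m * (y₁ - y) ^ 2 = 2 * τ * ((2 * (k + 1)) * u / (m * (m - 1))) := by
      rw [show u / m * (y₁ - y) ^ 2 = u * (y₁ - y) ^ 2 / m by ring, e, hτ]
      field_simp
    rw [e']
    refine mul_le_of_le_one_right (by positivity) (div_le_one_of_le₀ ?_ (by positivity))
    exact mul_le_mul (by linarith) (by linarith) hu hm0.le
  have s₂ : (1 + u : ℝ) * (y₂ - y) ^ 2 ≤ 4 / m := by
    have h1 : (y₂ - y) ^ 2 ≤ (2 / m) ^ 2 := sq_le_sq' (by linarith [neg_abs_le (y₂ - y)])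
      ((le_abs_self _).trans habs₂)
    calc _ ≤ m * (2 / m) ^ 2 := by gcongr; linarith
      _ = _ := by field_simp; norm_num
  have s₃ : 2 * k * (y₃ - y) ^ 2 ≤ 144 / m := by
    have e : 2 * k * (y₃ - y) ^ 2 = 2 * k * ((2 * m + 2 * u) / (m * (m - 2))) ^ 2 := by
      rcases eq_or_ne (2 * k : ℝ) 0 with h | h
      · simp [h]
      · rw [mul_left_cancel₀ h d₃]; ring
    rw [e]
    have h1 : (2 * m + 2 * u) / (m * (m - 2)) ≤ 12 / m := by
      rw [div_le_div_iff₀ (by positivity) hm0]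
      linarith
    calc _ ≤ m * (12 / m) ^ 2 := by gcongr; linarith
      _ = _ := by field_simp; norm_num
  have hDτ : D ≤ 4 * τ := by
    have : 2 * u / (m * (m - 2)) ≤ 2 / m := by
      rw [div_le_div_iff₀ (by positivity) hm0]
      linarith
    calc D ≤ 2 * m * τ * (2 / m) := by rw [hD, ← hqτ]; gcongr
      _ = _ := by field_simp; ring
  have hD0 : 0 ≤ D := by rw [hD]; positivity
  have hPc : (u : ℂ) / m + q * (1 + u) + 2 * k * q = 1 := by exact_mod_cast hP
  have hdc : (u : ℂ) / m * (y₁ - y) + q * ((1 + u) * (y₂ - y) + 2 * k * (y₃ - y)) +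
      q * (1 + y) = D := by exact_mod_cast hdrift
  rw [← hq, ← hτ]
  have key : (u : ℂ) / m * φ₁ + q * ((z + u) * φ₂ + 2 * k * φ₃) - φ =
      ((u / m : ℝ) : ℂ) * (φ₁ - φ - (y₁ - y) * c) +
      ((q : ℝ) : ℂ) * (((1 + u : ℝ) : ℂ) * (φ₂ - φ - (y₂ - y) * c) +
        ((2 * k : ℝ) : ℂ) * (φ₃ - φ - (y₃ - y) * c)) +
      ((q : ℝ) : ℂ) * ((z - 1) * (φ₂ - φ)) + ((D : ℝ) : ℂ) * c := by
    push_cast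
    linear_combination φ * hPc + c * hdc + q * hcz
  have nr : ∀ (r : ℝ) (w : ℂ), 0 ≤ r → ‖(r : ℂ) * w‖ = r * ‖w‖ := fun r w hr => by
    rw [norm_mul, Complex.norm_of_nonneg hr]
  rw [key]
  calc _ ≤ (u / m) * (B * (y₁ - y) ^ 2) + q * ((1 + u) * (B * (y₂ - y) ^ 2) +
        2 * k * (B * (y₃ - y) ^ 2)) + q * (‖z - 1‖ * (B * |y₂ - y|)) +
        D * (‖z - 1‖ * B) := by
        refine (norm_add₄_le).trans ?_
        rw [nr _ _ (by positivity), nr _ _ hq0, nr _ _ hq0, nr _ _ hD0, norm_mul]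
        gcongr
        refine (norm_add_le _ _).trans ?_
        rw [nr _ _ (by positivity), nr _ _ (by positivity)]
        gcongr
    _ = B * ((u / m) * (y₁ - y) ^ 2) + 2 * m * τ * (B * ((1 + u) * (y₂ - y) ^ 2) +
        B * (2 * k * (y₃ - y) ^ 2)) + 2 * m * τ * (‖z - 1‖ * (B * |y₂ - y|)) +
        D * (‖z - 1‖ * B) := by rw [hqτ]; ring
    _ ≤ B * (2 * τ) + 2 * m * τ * (B * (4 / m) + B * (144 / m)) +
        2 * m * τ * (‖z - 1‖ * (B * (2 / m))) + 4 * τ * (‖z - 1‖ * B) := by gcongr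
    -- Here `298 = 2 + 2 * (4 + 144)` comes from the Taylor remainders, and `8 = 4 + 4` from `φ₂ -
    -- φ` and from `D`.
    _ = (298 * B + 8 * ‖z - 1‖ * B) * τ := by field_simp; ring

/-- The limiting generating function satisfies the recursion of `luckyPGF` up to a small error. -/
lemma exists_limitPGF_consistency (z : ℂ) : ∃ C : ℝ, 0 ≤ C ∧ ∀ k u : ℕ,
    ‖(u : ℂ) / (2 * (k + 1) + u) * limitPGF z (2 * (k + 1 : ℕ) / (2 * (k + 1 : ℕ) + (u - 1 : ℕ))) +
    2 * (k + 1) / ((2 * (k + 1) + u) * (2 * k + 1 + u)) *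
      ((z + u) * limitPGF z (2 * k / (2 * k + u)) +
        2 * k * limitPGF z (2 * (k - 1 : ℕ) / (2 * (k - 1 : ℕ) + (u + 2 : ℕ)))) -
      limitPGF z (2 * (k + 1 : ℕ) / (2 * (k + 1 : ℕ) + u))‖ ≤
    C * ((k + 1) / ((2 * (k + 1) + u) ^ 2 * (2 * k + 1 + u))) := by
  obtain ⟨B, hB, hb, hlip, htay⟩ := exists_limitPGF_taylor_bound z
  -- The last summand serves the state with a single unseen pair left, where the source factor is `1
  -- / 4` and the error is at most `(‖z‖ + 1) * B`.
  refine ⟨298 * B + 8 * ‖z - 1‖ * B + 4 * (‖z‖ + 1) * B, by positivity, fun k u => ?_⟩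
  have hk : (0 : ℝ) ≤ k := k.cast_nonneg
  have hu : (0 : ℝ) ≤ u := u.cast_nonneg
  have hfrac : ∀ i j : ℕ, (2 * i / (2 * i + j) : ℝ) ∈ Set.Icc (0 : ℝ) 1 := fun i j =>
    ⟨by positivity, div_le_one_of_le₀ (by linarith [(j.cast_nonneg : (0 : ℝ) ≤ j)])
      (by positivity)⟩
  have m0 := hfrac (k + 1) u
  have m1 := hfrac (k + 1) (u - 1)
  have m2 := hfrac k u
  have m3 := hfrac (k - 1) (u + 2)
  rcases Nat.eq_zero_or_pos (2 * k + u) with hz | hz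
  · obtain rfl : k = 0 := by omega
    obtain rfl : u = 0 := by omega
    have b0 := hb 0 (by simp)
    have b1 := hb 1 (by simp)
    have : ‖z * limitPGF z 0 - limitPGF z 1‖ ≤ ‖z‖ * B + B := by
      refine (norm_sub_le _ _).trans ?_
      rw [norm_mul]
      gcongr
    norm_num
    nlinarith [norm_nonneg z, norm_nonneg (z - 1), mul_nonneg (norm_nonneg (z - 1)) hB]
  set y : ℝ := 2 * (k + 1 : ℕ) / (2 * (k + 1 : ℕ) + u) with hy
  set y₁ : ℝ := 2 * (k + 1 : ℕ) / (2 * (k + 1 : ℕ) + (u - 1 : ℕ)) with hy₁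
  set y₂ : ℝ := 2 * k / (2 * k + u) with hy₂
  set y₃ : ℝ := 2 * (k - 1 : ℕ) / (2 * (k - 1 : ℕ) + (u + 2 : ℕ)) with hy₃
  obtain ⟨m, hm⟩ : ∃ m : ℝ, m = 2 * (k + 1) + u := ⟨_, rfl⟩
  have hm3 : 3 ≤ m := by
    have : (1 : ℝ) ≤ 2 * k + u := by exact_mod_cast hz
    linarith
  have hm1 : (0 : ℝ) < m - 1 := by linarith
  have hm2 : (0 : ℝ) < m - 2 := by linarith
  have hm0 : (0 : ℝ) < m := by linarith
  have d₁ : (u : ℝ) * (y₁ - y) = u * (2 * (k + 1) / (m * (m - 1))) := by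
    rcases Nat.eq_zero_or_pos u with rfl | hu1
    · simp
    · rw [hy₁, hy, Nat.cast_sub hu1]
      push_cast
      rw [show (2 * ((k : ℝ) + 1) + (u - 1)) = m - 1 by linarith, ← hm]
      field_simp
      ring
  have d₂ : y₂ - y = -(2 * u) / (m * (m - 2)) := by
    rw [hy₂, hy]
    push_cast
    rw [← hm, show (2 * (k : ℝ) + u) = m - 2 by linarith,
      show (u : ℝ) = m - 2 * (k + 1) by linarith]
    field_simp
    ring
  have d₃ : 2 * (k : ℝ) * (y₃ - y) = 2 * k * (-(2 * m + 2 * u) / (m * (m - 2))) := by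
    rcases Nat.eq_zero_or_pos k with rfl | hk1
    · simp
    · rw [hy₃, hy, Nat.cast_sub hk1]
      push_cast
      rw [← hm, show (2 * ((k : ℝ) - 1) + (u + 2)) = m - 2 by linarith,
        show (u : ℝ) = m - 2 * (k + 1) by linarith]
      field_simp
      ring
  have hy0 : (1 + y : ℂ) ≠ 0 := by
    have : (1 + y : ℝ) ≠ 0 := by linarith [m0.1]
    exact_mod_cast this
  obtain ⟨c, hc⟩ : ∃ c : ℂ, c = (z - 1) / (1 + y) * limitPGF z y := ⟨_, rfl⟩
  have hcz : (z - 1) * limitPGF z y = (1 + y) * c := by rw [hc]; field_simp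
  have hcn : ‖c‖ ≤ ‖z - 1‖ * B := by
    rw [hc, norm_mul, norm_div]
    have h1 : (1 : ℝ) ≤ ‖(1 + y : ℂ)‖ := by
      have : (1 + y : ℂ) = ((1 + y : ℝ) : ℂ) := by push_cast; rfl
      rw [this, Complex.norm_of_nonneg (by linarith [m0.1])]
      linarith [m0.1]
    gcongr
    · exact div_le_self (norm_nonneg _) h1
    · exact hb y m0
  have t₁ := htay y m0 y₁ m1
  have t₂ := htay y m0 y₂ m2
  have t₃ := htay y m0 y₃ m3
  have l₂ := hlip y m0 y₂ m2
  rw [← hc] at t₁ t₂ t₃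
  have hmc : (2 * (k + 1) + u : ℂ) = m := by rw [hm]; push_cast; rfl
  have hqc : (2 * (k + 1) / ((2 * (k + 1) + u) * (2 * k + 1 + u)) : ℂ) =
      ((2 * (k + 1) / (m * (m - 1)) : ℝ) : ℂ) := by
    rw [hm]; push_cast; congr 2; ring
  have hτr : ((k + 1) / ((2 * (k + 1) + u) ^ 2 * (2 * k + 1 + u)) : ℝ) =
      (k + 1) / (m ^ 2 * (m - 1)) := by
    rw [hm]; congr 2; ring
  have hfin := norm_recursion_error_le hm hk hu hm3 hB (by rw [hy, hm]; push_cast; rfl)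
    d₁ d₂ d₃ hcz hcn t₁ t₂ t₃ l₂
  rw [hτr, hqc, hmc]
  refine le_trans (by simpa using hfin) ?_
  refine mul_le_mul_of_nonneg_right ?_ (by positivity)
  have : 0 ≤ 4 * (‖z‖ + 1) * B := by positivity
  linarith

/-- Subtract the two recursions. As `‖z‖ ≤ 1`, the coefficients are bounded in norm by those at `z =
1`, so the error obeys the inequality for which `errorBound` is a supersolution. At `k = 0` both
functions equal 1, also for `u = 0` since `0 / 0 = 0`. -/
lemma exists_luckyPGF_error (z : ℂ) (hz : ‖z‖ ≤ 1) : ∃ C : ℝ, 0 ≤ C ∧ ∀ k u : ℕ,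
    ‖luckyPGF z k u - limitPGF z (2 * k / (2 * k + u))‖ ≤ C * errorBound k u := by
  obtain ⟨C, hC, hcons⟩ := exists_limitPGF_consistency z
  refine ⟨C, hC, fun k => ?_⟩
  induction k using Nat.strong_induction_on with
  | _ k ihk =>
  cases k with
  | zero => intro u; simp [luckyPGF_zero, limitPGF, errorBound]
  | succ k =>
    intro u
    -- The inner induction is on `u`; the factor `u` in the hypothesis makes it trivial at `u = 0`.
    have step : ∀ u : ℕ, ((u : ℝ) * ‖luckyPGF z (k + 1) (u - 1) -
        limitPGF z (2 * (k + 1 : ℕ) / (2 * (k + 1 : ℕ) + (u - 1 : ℕ)))‖ ≤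
        u * (C * errorBound (k + 1) (u - 1))) →
        ‖luckyPGF z (k + 1) u - limitPGF z (2 * (k + 1 : ℕ) / (2 * (k + 1 : ℕ) + u))‖ ≤
          C * errorBound (k + 1) u := by
      intro u hu
      set g₁ := luckyPGF z (k + 1) (u - 1)
      set h₁ := limitPGF z (2 * (k + 1 : ℕ) / (2 * (k + 1 : ℕ) + (u - 1 : ℕ)))
      have i2 := ihk k (by omega) u
      have i3 := ihk (k - 1) (by omega) (u + 2)
      have hc := hcons k u
      rw [luckyPGF_succ]
      set g₂ := luckyPGF z k u
      set h₂ := limitPGF z (2 * k / (2 * k + u))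
      set g₃ := luckyPGF z (k - 1) (u + 2)
      set h₃ := limitPGF z (2 * (k - 1 : ℕ) / (2 * (k - 1 : ℕ) + (u + 2 : ℕ)))
      set h₀ := limitPGF z (2 * (k + 1 : ℕ) / (2 * (k + 1 : ℕ) + u))
      have n1 : ‖(1 / (2 * (k + 1) + u) : ℂ)‖ = 1 / (2 * (k + 1) + u) := by
        have : (1 / (2 * (k + 1) + u) : ℂ) = ((1 / (2 * (k + 1) + u) : ℝ) : ℂ) := by push_cast; rfl
        rw [this, Complex.norm_of_nonneg (by positivity)]
      have n2 : ‖(2 * (k + 1) / ((2 * (k + 1) + u) * (2 * k + 1 + u)) : ℂ)‖ =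
          2 * (k + 1) / ((2 * (k + 1) + u) * (2 * k + 1 + u)) := by
        have : (2 * (k + 1) / ((2 * (k + 1) + u) * (2 * k + 1 + u)) : ℂ) =
          ((2 * (k + 1) / ((2 * (k + 1) + u) * (2 * k + 1 + u)) : ℝ) : ℂ) := by push_cast; rfl
        rw [this, Complex.norm_of_nonneg (by positivity)]
      have n3 : ‖z + u‖ ≤ 1 + u := (norm_add_le _ _).trans (by simpa using hz)
      have n4 : ‖(2 * k : ℂ)‖ = 2 * k := by simp
      calc _ = ‖1 / (2 * (k + 1) + u : ℂ) * (u * (g₁ - h₁)) +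
            2 * (k + 1) / ((2 * (k + 1) + u) * (2 * k + 1 + u)) *
            ((z + u) * (g₂ - h₂) + 2 * k * (g₃ - h₃)) + ((u : ℂ) / (2 * (k + 1) + u) * h₁ +
            2 * (k + 1) / ((2 * (k + 1) + u) * (2 * k + 1 + u)) *
            ((z + u) * h₂ + 2 * k * h₃) - h₀)‖ := by congr 1; ring
        _ ≤ 1 / (2 * (k + 1) + u) * (u * ‖g₁ - h₁‖) +
            2 * (k + 1) / ((2 * (k + 1) + u) * (2 * k + 1 + u)) *
            ((1 + u) * ‖g₂ - h₂‖ + 2 * k * ‖g₃ - h₃‖) +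
            C * ((k + 1) / ((2 * (k + 1) + u) ^ 2 * (2 * k + 1 + u))) := by
          refine (norm_add₃_le).trans ?_
          rw [norm_mul, n1, norm_mul, Complex.norm_natCast, norm_mul, n2]
          gcongr
          refine (norm_add_le _ _).trans ?_
          rw [norm_mul, norm_mul, n4]
          gcongr
        _ ≤ 1 / (2 * (k + 1) + u) * (u * (C * errorBound (k + 1) (u - 1))) +
            2 * (k + 1) / ((2 * (k + 1) + u) * (2 * k + 1 + u)) *
            ((1 + u) * (C * errorBound k u) + 2 * k * (C * errorBound (k - 1) (u + 2))) +
            C * ((k + 1) / ((2 * (k + 1) + u) ^ 2 * (2 * k + 1 + u))) := by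
          gcongr
        _ = C * ((u : ℝ) / (2 * (k + 1) + u) * errorBound (k + 1) (u - 1) +
            2 * (k + 1) / ((2 * (k + 1) + u) * (2 * k + 1 + u)) *
            ((1 + u) * errorBound k u + 2 * k * errorBound (k - 1) (u + 2)) +
            (k + 1) / ((2 * (k + 1) + u) ^ 2 * (2 * k + 1 + u))) := by ring
        _ ≤ _ := by
          gcongr
          exact errorBound_supersolution k u
    induction u with
    | zero => exact step 0 (by simp)
    | succ v ih =>
      refine step (v + 1) ?_
      simp only [Nat.add_sub_cancel]
      gcongr

lemma tendsto_errorBound : Tendsto (fun n => errorBound n 0) atTop (nhds 0) := by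
  have h1 : Tendsto (fun x : ℝ => (1 + Real.log x) / x) atTop (nhds 0) := by
    have := tendsto_inv_atTop_zero.add Real.isLittleO_log_id_atTop.tendsto_div_nhds_zero
    simp only [add_zero] at this
    refine this.congr fun x => ?_
    simp only [id]
    ring
  have h2 : Tendsto (fun n : ℕ => ((2 * n : ℕ) : ℝ)) atTop atTop :=
    tendsto_natCast_atTop_atTop.comp (tendsto_id.const_mul_atTop' (by norm_num))
  refine squeeze_zero' (Eventually.of_forall fun n => errorBound_nonneg n 0) ?_ (h1.comp h2)
  filter_upwards [eventually_ge_atTop 1] with n hn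
  have hn' : (1 : ℝ) ≤ n := by exact_mod_cast hn
  have hlog := harmonic_le_one_add_log (2 * n)
  have hlog0 : 0 ≤ Real.log ((2 * n : ℕ) : ℝ) := Real.log_natCast_nonneg _
  have hfac : (n : ℝ) / (2 * n * (2 * n - 1)) ≤ 1 / ((2 * n : ℕ) : ℝ) := by
    push_cast
    have : (0 : ℝ) < 2 * n - 1 := by linarith
    rw [div_le_div_iff₀ (by positivity) (by positivity)]
    nlinarith
  calc errorBound n 0 = n / (2 * n * (2 * n - 1)) * (harmonic (2 * n) : ℝ) := by
        simp [errorBound]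
    _ ≤ 1 / ((2 * n : ℕ) : ℝ) * (1 + Real.log ((2 * n : ℕ) : ℝ)) := by
        refine (mul_le_mul_of_nonneg_right hfac ?_).trans
          (mul_le_mul_of_nonneg_left hlog (by positivity))
        exact_mod_cast (harmonic_pos (by omega : 2 * n ≠ 0)).le
    _ = _ := by simp only [Function.comp]; ring

lemma tendsto_luckyPGF (z : ℂ) (hz : ‖z‖ ≤ 1) :
    Tendsto (fun n => luckyPGF z n 0) atTop (nhds (limitPGF z 1)) := by
  obtain ⟨C, -, hC⟩ := exists_luckyPGF_error z hz
  rw [tendsto_iff_norm_sub_tendsto_zero]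
  refine squeeze_zero' (Eventually.of_forall fun _ => norm_nonneg _) ?_
    (by simpa using tendsto_errorBound.const_mul C)
  filter_upwards [eventually_ge_atTop 1] with n hn
  have hn' : (2 * n : ℝ) ≠ 0 := by positivity
  simpa [div_self hn'] using hC n 0

/-! ### Counting words: the recursion as conditioning on the first letters -/

section Arrangements

variable {α : Type*} [DecidableEq α]

/-- The words with the given multiset of letters. -/
def arrangements (s : Multiset α) : Finset (List α) := s.lists.toFinset

lemma mem_arrangements {s : Multiset α} {w : List α} : w ∈ arrangements s ↔ (w : Multiset α) = s := by
  simp [arrangements, eq_comm]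

/-- The multiset of labels in which those in `K` occur twice and those in `U` once. -/
def stock (K U : Finset α) : Multiset α := K.val + K.val + U.val

lemma stock_insert_left {K U : Finset α} {a : α} (hK : a ∉ K) (hU : a ∉ U) :
    stock (insert a K) U = a ::ₘ stock K (insert a U) := by
  simp only [stock, Finset.insert_val_of_notMem hK, Finset.insert_val_of_notMem hU]
  simp [Multiset.cons_add, Multiset.add_cons]

lemma stock_insert_right {K U : Finset α} {a : α} (hU : a ∉ U) :
    stock K (insert a U) = a ::ₘ stock K U := by
  simp only [stock, Finset.insert_val_of_notMem hU]
  simp [Multiset.add_cons]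

lemma sum_arrangements {M : Type*} [AddCommMonoid M] {s : Multiset α} (hs : s ≠ 0)
    (f : List α → M) : ∑ w ∈ arrangements s, f w =
      ∑ a ∈ s.toFinset, ∑ w ∈ arrangements (s.erase a), f (a :: w) := by
  have h : arrangements s = s.toFinset.biUnion fun a =>
      (arrangements (s.erase a)).map ⟨List.cons a, List.cons_injective⟩ := by
    ext w
    simp only [mem_arrangements, Finset.mem_biUnion, Multiset.mem_toFinset, Finset.mem_map,
      Function.Embedding.coeFn_mk]
    constructor
    · rintro rfl
      cases w with
      | nil => simp at hs
      | cons a w => exact ⟨a, by simp, w, by simp, rfl⟩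
    · rintro ⟨a, ha, w, hw, rfl⟩
      rw [← Multiset.cons_coe, hw, Multiset.cons_erase ha]
  rw [h, Finset.sum_biUnion]
  · simp
  · intro a _ b _ hab
    simp only [Function.onFun, Finset.disjoint_left, Finset.mem_map, Function.Embedding.coeFn_mk]
    rintro _ ⟨w, _, rfl⟩ ⟨v, _, h⟩
    exact hab (List.cons.inj h).1.symm

/-- The first letter is either the only copy of a label in `U`, which disappears, or one of two
copies of a label in `K`, which then moves to `U`. -/
lemma sum_arrangements_stock {M : Type*} [AddCommMonoid M] {K U : Finset α} (hKU : Disjoint K U)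
    (hne : (K ∪ U).Nonempty) (f : List α → M) :
    ∑ w ∈ arrangements (stock K U), f w =
      ∑ a ∈ U, ∑ w ∈ arrangements (stock K (U.erase a)), f (a :: w) +
      ∑ a ∈ K, ∑ w ∈ arrangements (stock (K.erase a) (insert a U)), f (a :: w) := by
  have hto : (stock K U).toFinset = U ∪ K := by
    ext a
    simp [stock, or_comm]
  rw [sum_arrangements, hto, Finset.sum_union hKU.symm]
  · congr 1
    · refine Finset.sum_congr rfl fun a ha => ?_
      congr 2
      conv_lhs => rw [← Finset.insert_erase ha, stock_insert_right (Finset.notMem_erase a U)]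
      simp
    · refine Finset.sum_congr rfl fun a ha => ?_
      congr 2
      conv_lhs => rw [← Finset.insert_erase ha, stock_insert_left (Finset.notMem_erase a K)
        (Finset.disjoint_left.1 hKU ha)]
      simp
  · intro h
    rw [h] at hto
    rw [Finset.union_comm, ← hto] at hne
    simp at hne

/-- The number of words in which `k` labels occur twice and `u` labels occur once. -/
noncomputable def wordCount (k u : ℕ) : ℂ := (2 * k + u).factorial / 2 ^ k

lemma wordCount_ne_zero (k u : ℕ) : wordCount k u ≠ 0 := by
  unfold wordCount
  exact div_ne_zero (by exact_mod_cast Nat.factorial_ne_zero _) (by simp)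

lemma wordCount_succ_right (k u : ℕ) :
    wordCount k (u + 1) = (2 * k + u + 1) * wordCount k u := by
  unfold wordCount
  rw [← add_assoc, Nat.factorial_succ]
  push_cast
  ring

lemma wordCount_succ_left (k u : ℕ) :
    wordCount (k + 1) u = (2 * k + u + 2) / 2 * wordCount k (u + 1) := by
  unfold wordCount
  rw [show 2 * (k + 1) + u = (2 * k + (u + 1)) + 1 by ring, Nat.factorial_succ, pow_succ]
  push_cast
  ring

lemma card_arrangements_stock (K U : Finset α) (hKU : Disjoint K U) :
    ((arrangements (stock K U)).card : ℂ) = wordCount K.card U.card := by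
  induction hN : 2 * K.card + U.card generalizing K U with
  | zero =>
    obtain rfl : K = ∅ := Finset.card_eq_zero.1 (by omega)
    obtain rfl : U = ∅ := Finset.card_eq_zero.1 (by omega)
    have : arrangements (stock (∅ : Finset α) ∅) = {[]} := by
      ext w; simp [mem_arrangements, stock]
    simp [this, wordCount]
  | succ N ih =>
    have hne : (K ∪ U).Nonempty := by
      rw [Finset.nonempty_iff_ne_empty]
      intro h
      obtain ⟨rfl, rfl⟩ := Finset.union_eq_empty.1 h
      simp at hN
    have h := sum_arrangements_stock hKU hne (fun _ => (1 : ℂ))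
    simp only [Finset.sum_const, nsmul_eq_mul, mul_one] at h
    rw [h]
    have e1 : ∀ a ∈ U, ((arrangements (stock K (U.erase a))).card : ℂ) =
        wordCount K.card (U.card - 1) := by
      intro a ha
      have hc := Finset.card_erase_of_mem ha
      have hpos := Finset.card_pos.2 ⟨a, ha⟩
      rw [ih K (U.erase a) (hKU.mono_right (Finset.erase_subset _ _)) (by omega), hc]
    have e2 : ∀ a ∈ K, ((arrangements (stock (K.erase a) (insert a U))).card : ℂ) =
        wordCount (K.card - 1) (U.card + 1) := by
      intro a ha
      have haU := Finset.disjoint_left.1 hKU ha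
      have hc := Finset.card_erase_of_mem ha
      have hc' := Finset.card_insert_of_notMem haU
      have hpos := Finset.card_pos.2 ⟨a, ha⟩
      rw [ih _ _ _ (by omega), hc, hc']
      rw [Finset.disjoint_insert_right]
      exact ⟨Finset.notMem_erase a K, hKU.mono_left (Finset.erase_subset _ _)⟩
    rw [Finset.sum_congr rfl e1, Finset.sum_congr rfl e2]
    simp only [Finset.sum_const, nsmul_eq_mul]
    generalize K.card = k at *
    generalize U.card = u at *
    clear ih e1 e2 h
    -- Words beginning with a label of `K` make up the fraction `2k / (2k + u)`; `hdiv'` gives the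
    -- complementary fraction.
    have hdiv : ∀ k u : ℕ, (k : ℂ) * wordCount (k - 1) (u + 1) * (2 * k + u) =
        2 * k * wordCount k u := by
      intro k u
      cases k with
      | zero => simp
      | succ k =>
        rw [wordCount_succ_left]
        simp only [Nat.add_sub_cancel]
        push_cast
        ring
    have hdiv' : ∀ k u : ℕ, (u : ℂ) * wordCount k (u - 1) * (2 * k + u) = u * wordCount k u := by
      intro k u
      cases u with
      | zero => simp
      | succ u =>
        rw [wordCount_succ_right]
        simp only [Nat.add_sub_cancel]
        push_cast
        ring
    have hm : (2 * k + u : ℂ) ≠ 0 := by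
      have : 2 * k + u ≠ 0 := by omega
      exact_mod_cast this
    apply mul_right_cancel₀ hm
    linear_combination hdiv k u + hdiv' k u

/-- The sum over all words of labels of the generating function of the number of lucky moves. -/
lemma sum_luckyWord (z : ℂ) (K U T : Finset α) (hKT : Disjoint K T) (hUT : U ⊆ T) :
    ∑ w ∈ arrangements (stock K U), z ^ luckyWord T w =
      wordCount K.card U.card * luckyPGF z K.card U.card := by
  induction hN : 2 * K.card + U.card using Nat.strong_induction_on generalizing K U T with
  | _ N ih =>
  have hKU : Disjoint K U := hKT.mono_right hUT
  rcases K.eq_empty_or_nonempty with rfl | hK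
  · have hzero : ∀ (w : List α), (∀ x ∈ w, x ∈ T) → luckyWord T w = 0 := by
      intro w
      induction w with
      | nil => intro; rfl
      | cons a w ihw =>
        intro h
        cases w with
        | nil => rfl
        | cons b w =>
          rw [luckyWord, if_pos (h a (by simp))]
          exact ihw fun x hx => h x (by simp [hx])
    rw [Finset.card_empty, luckyPGF_zero, mul_one, ← Finset.card_empty (α := α),
      ← card_arrangements_stock _ _ (Finset.disjoint_empty_left U), Finset.card_eq_sum_ones]
    push_cast
    refine Finset.sum_congr rfl fun w hw => ?_
    rw [hzero w, pow_zero]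
    intro x hx
    apply hUT
    have : x ∈ stock ∅ U := by rw [← mem_arrangements.1 hw]; simpa using hx
    simpa [stock] using this
  obtain ⟨k, hk⟩ : ∃ k, K.card = k + 1 := ⟨K.card - 1, by have := hK.card_pos; omega⟩
  obtain ⟨u, hu⟩ : ∃ u, U.card = u := ⟨_, rfl⟩
  rw [sum_arrangements_stock hKU (hK.mono Finset.subset_union_left)]
  have e1 : ∀ a ∈ U, ∑ w ∈ arrangements (stock K (U.erase a)), z ^ luckyWord T (a :: w) =
      wordCount (k + 1) (u - 1) * luckyPGF z (k + 1) (u - 1) := by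
    intro a ha
    have hc := Finset.card_erase_of_mem ha
    have hpos := Finset.card_pos.2 ⟨a, ha⟩
    rw [← hk, ← hu, ← hc, ← ih _ (by omega) K (U.erase a) T hKT
      ((Finset.erase_subset _ _).trans hUT) rfl]
    refine Finset.sum_congr rfl fun w _ => ?_
    cases w with
    | nil => rfl
    | cons b r => rw [luckyWord, if_pos (hUT ha)]
  have e2 : ∀ a ∈ K, ∑ w ∈ arrangements (stock (K.erase a) (insert a U)),
      z ^ luckyWord T (a :: w) =
      (z + u) * (wordCount k u * luckyPGF z k u) +
      k * (wordCount (k - 1) (u + 2) * luckyPGF z (k - 1) (u + 2)) := by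
    intro a ha
    have haT : a ∉ T := Finset.disjoint_left.1 hKT ha
    have haU : a ∉ U := fun h => haT (hUT h)
    have hcK : (K.erase a).card = k := by rw [Finset.card_erase_of_mem ha]; omega
    have hcU : (insert a U).card = u + 1 := by rw [Finset.card_insert_of_notMem haU, hu]
    have hdisj : Disjoint (K.erase a) (insert a U) := by
      rw [Finset.disjoint_insert_right]
      exact ⟨Finset.notMem_erase a K, hKU.mono_left (Finset.erase_subset _ _)⟩
    have hdT : Disjoint (K.erase a) (insert a T) := by
      rw [Finset.disjoint_insert_right]
      exact ⟨Finset.notMem_erase a K, hKT.mono_left (Finset.erase_subset _ _)⟩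
    rw [sum_arrangements_stock hdisj ⟨a, by simp⟩, Finset.sum_insert haU]
    -- The second card after a new label `a` is its mate (`f1`, the lucky case), the mate of a label
    -- seen earlier (`f2`), or another new label (`f3`).
    have f1 : ∑ w ∈ arrangements (stock (K.erase a) ((insert a U).erase a)),
        z ^ luckyWord T (a :: a :: w) = z * (wordCount k u * luckyPGF z k u) := by
      rw [Finset.erase_insert haU, ← hcK, ← hu,
        ← ih _ (by omega) (K.erase a) U (insert a T) hdT
          (hUT.trans (Finset.subset_insert _ _)) rfl, Finset.mul_sum]
      refine Finset.sum_congr rfl fun w _ => ?_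
      rw [luckyWord, if_neg haT, if_pos rfl, pow_add, pow_one, Finset.insert_idem]
    have f2 : ∀ b ∈ U, ∑ w ∈ arrangements (stock (K.erase a) ((insert a U).erase b)),
        z ^ luckyWord T (a :: b :: w) = wordCount k u * luckyPGF z k u := by
      intro b hb
      have hab : a ≠ b := fun h => haU (h ▸ hb)
      have hc : ((insert a U).erase b).card = u := by
        rw [Finset.card_erase_of_mem (Finset.mem_insert_of_mem hb), hcU]; omega
      rw [← hcK]
      conv_rhs => rw [← hc]
      rw [← ih _ (by omega) (K.erase a) ((insert a U).erase b) (insert b (insert a T)) ?_ ?_ rfl]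
      · refine Finset.sum_congr rfl fun w _ => ?_
        rw [luckyWord, if_neg haT, if_neg hab, zero_add]
      · rw [Finset.disjoint_insert_right]
        exact ⟨fun h => Finset.disjoint_left.1 hdisj h (Finset.mem_insert_of_mem hb), hdT⟩
      · exact (Finset.erase_subset _ _).trans
          ((Finset.insert_subset_insert a hUT).trans (Finset.subset_insert _ _))
    have f3 : ∀ b ∈ K.erase a,
        ∑ w ∈ arrangements (stock ((K.erase a).erase b) (insert b (insert a U))),
        z ^ luckyWord T (a :: b :: w) = wordCount (k - 1) (u + 2) * luckyPGF z (k - 1) (u + 2) := by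
      intro b hb
      have hab : a ≠ b := (Finset.ne_of_mem_erase hb).symm
      have hpos := Finset.card_pos.2 ⟨b, hb⟩
      have hc1 : ((K.erase a).erase b).card = k - 1 := by rw [Finset.card_erase_of_mem hb, hcK]
      have hc2 : (insert b (insert a U)).card = u + 2 := by
        rw [Finset.card_insert_of_notMem (Finset.disjoint_left.1 hdisj hb), hcU]
      rw [← hc1, ← hc2, ← ih _ (by omega) ((K.erase a).erase b) (insert b (insert a U))
        (insert b (insert a T)) ?_ ?_ rfl]
      · refine Finset.sum_congr rfl fun w _ => ?_
        rw [luckyWord, if_neg haT, if_neg hab, zero_add]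
      · rw [Finset.disjoint_insert_right]
        exact ⟨Finset.notMem_erase b _, hdT.mono_left (Finset.erase_subset _ _)⟩
      · exact Finset.insert_subset_insert b (Finset.insert_subset_insert a hUT)
    rw [f1, Finset.sum_congr rfl f2, Finset.sum_congr rfl f3]
    simp only [Finset.sum_const, nsmul_eq_mul, hcK, hu]
    ring
  rw [Finset.sum_congr rfl e1, Finset.sum_congr rfl e2]
  simp only [Finset.sum_const, nsmul_eq_mul, hk, hu]
  rw [luckyPGF_succ z k u]
  have hm : (2 * (k + 1) + u : ℂ) ≠ 0 := by
    have : 2 * (k + 1) + u ≠ 0 := by omega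
    exact_mod_cast this
  have hm1 : (2 * k + 1 + u : ℂ) ≠ 0 := by
    have : 2 * k + 1 + u ≠ 0 := by omega
    exact_mod_cast this
  -- The ratios of word counts in `w1`, `w2` and `w3` are the transition probabilities of the
  -- recursion.
  have w0 : wordCount (k + 1) u = (2 * (k + 1) + u) * (2 * k + 1 + u) / 2 * wordCount k u := by
    rw [wordCount_succ_left, wordCount_succ_right]; ring
  have w1 : (u : ℂ) * wordCount (k + 1) (u - 1) =
      u / (2 * (k + 1) + u) * wordCount (k + 1) u := by
    cases u with
    | zero => simp
    | succ u =>
      rw [wordCount_succ_right]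
      simp only [Nat.add_sub_cancel]
      push_cast at hm ⊢
      field_simp
      ring
  have w2 : (k : ℂ) * wordCount (k - 1) (u + 2) = 2 * k * wordCount k u := by
    cases k with
    | zero => simp
    | succ k =>
      rw [wordCount_succ_left k u, show u + 2 = (u + 1) + 1 from rfl]
      simp only [Nat.add_sub_cancel, wordCount_succ_right k (u + 1)]
      push_cast
      ring
  have w3 : 2 * (k + 1) / ((2 * (k + 1) + u) * (2 * k + 1 + u)) * wordCount (k + 1) u =
      (k + 1) * wordCount k u := by
    rw [w0]; field_simp
  push_cast
  linear_combination luckyPGF z (k + 1) (u - 1) * w1 +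
    (k + 1) * luckyPGF z (k - 1) (u + 2) * w2 -
    ((z + u) * luckyPGF z k u + 2 * k * luckyPGF z (k - 1) (u + 2)) * w3

end Arrangements

/-! ### From words back to random deals, and convergence -/

lemma ofFn_mem_arrangements {n : ℕ} (d : Fin (2 * n) → Fin n) :
    List.ofFn d ∈ arrangements (stock (Finset.univ : Finset (Fin n)) ∅) ↔
      ∀ i, (Finset.univ.filter fun j => d j = i).card = 2 := by
  rw [mem_arrangements, Multiset.ext]
  refine forall_congr' fun i => ?_
  rw [← Fin.univ_val_map, Multiset.count_map]
  simp only [eq_comm (a := i)]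
  simp [stock, Finset.card_def, Finset.filter_val]

lemma sum_deal {n : ℕ} (f : List (Fin n) → ℂ) :
    ∑ d : Deal n, f (List.ofFn d.1) =
      ∑ w ∈ arrangements (stock (Finset.univ : Finset (Fin n)) ∅), f w := by
  refine Finset.sum_bij (fun d _ => List.ofFn d.1)
    (fun d _ => (ofFn_mem_arrangements d.1).2 d.2)
    (fun d _ e _ h => Subtype.ext (List.ofFn_injective h)) (fun w hw => ?_) (fun _ _ => rfl)
  have hlen : w.length = 2 * n := by
    have := congrArg Multiset.card (mem_arrangements.1 hw)
    simp [stock] at this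
    omega
  obtain ⟨d, rfl⟩ : ∃ d : Fin (2 * n) → Fin n, List.ofFn d = w := by
    exact ⟨fun i => w.get (i.cast hlen.symm), by
      apply List.ext_getElem <;> simp [hlen]⟩
  exact ⟨⟨d, (ofFn_mem_arrangements d).1 hw⟩, Finset.mem_univ _, rfl⟩

/-- Deals correspond to the words with every label twice, so the mean over deals is the sum in
`sum_luckyWord` divided by the number of words. -/
lemma charFun_luckyMoves (n : ℕ) (t : ℝ) :
    charFun ((uniformDeal n).map fun d : Deal n => (d.luckyMoves : ℝ)) t =
      luckyPGF (Complex.exp (t * Complex.I)) n 0 := by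
  have hs := sum_luckyWord (Complex.exp (t * Complex.I)) (Finset.univ : Finset (Fin n)) ∅ ∅
    (by simp) (by simp)
  have hcard := card_arrangements_stock (Finset.univ : Finset (Fin n)) ∅ (by simp)
  rw [Finset.card_eq_sum_ones] at hcard
  push_cast at hcard
  rw [← sum_deal fun _ => 1] at hcard
  rw [← sum_deal fun w => Complex.exp (t * Complex.I) ^ luckyWord ∅ w] at hs
  simp only [← luckyMoves_eq_luckyWord] at hs
  simp only [Finset.sum_const, Finset.card_univ, nsmul_eq_mul, mul_one, Fintype.card_fin,
    Finset.card_empty] at hs hcard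
  rw [charFun_apply_real, integral_map (by fun_prop) (by fun_prop), uniformDeal,
    PMF.integral_eq_sum]
  have hne := wordCount_ne_zero n 0
  calc _ = (wordCount n 0)⁻¹ * ∑ d : Deal n, Complex.exp (t * Complex.I) ^ d.luckyMoves := by
        rw [Finset.mul_sum]
        refine Finset.sum_congr rfl fun d _ => ?_
        rw [← Complex.exp_nat_mul, ← hcard]
        simp [PMF.uniformOfFintype_apply]
        congr 1
        ring
    _ = _ := by rw [hs]; field_simp

theorem theorem2p6 :
    TendstoInDistribution (fun (n : ℕ) (d : Deal n) => (d.luckyMoves : ℝ)) atTop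
      (fun k : ℕ => (k : ℝ)) uniformDeal (poissonMeasure (Real.toNNReal (Real.log 2))) := by
  refine ⟨fun n => (measurable_from_top).aemeasurable, by fun_prop, ?_⟩
  refine ProbabilityMeasure.tendsto_iff_tendsto_charFun.2 fun t => ?_
  simp only [ProbabilityMeasure.coe_mk]
  rw [charFun_map_cast_poissonMeasure]
  simp only [charFun_luckyMoves]
  -- The argument `exp (i t)` lies on the unit circle, where the comparison applies, and `limitPGF`
  -- at 1 is `exp ((z - 1) * log 2)`.
  convert tendsto_luckyPGF (Complex.exp (t * Complex.I)) (by rw [Complex.norm_exp_ofReal_mul_I])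
    using 2
  rw [limitPGF, Real.coe_toNNReal _ (Real.log_nonneg (by norm_num)), mul_comm]
  norm_num
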